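/- **Theorem (linear lower bound for hypergraph sinkless orientation).** A *multihypergraph* $G=(V,E)$ has a finite set $V$ of vertices and a finite family $E$ of nonempty hyperedges (subsets of $V$, where the same subset may occur several times). The degree of a vertex is the number of hyperedges containing it, counted with multiplicity, and the rank of a hyperedge is the number of its vertices. A *hypergraph sinkless orientation* (HSO) of $G$ makes each hyperedge outgoing for exactly one of its vertices and incoming for its other vertices, in such a way that every vertex has at least one outgoing hyperedge. Algorithms run in the deterministic $\mathsf{LOCAL}$ model on the bipartite representation $\mathcal{B}_G$, the simple graph with node set $V\sqcup E$ in which $v\in V$ and $e\in E$ are adjacent if and only if $v\in e$. Each node of $\mathcal{B}_G$ has a unique identifier in $\{1,\dots,(|V|+|E|)^c\}$, where $c\ge 1$ is a fixed integer, and initially knows $|V|$, $|E|$, its own identifier, whether it is a vertex or a hyperedge, and the identifiers of its neighbours. In each synchronous round, every node sends one message of unbounded size to each of its neighbours and performs arbitrary local computation. An algorithm computes an HSO in $t$ rounds if after $t$ rounds every vertex outputs which of its incident hyperedges are outgoing for it, and these outputs together are those of an HSO of $G$. Let $\delta\ge 2$ and $c\ge 1$ be fixed integers, and let $T\colon\mathbb{N}\to\mathbb{N}$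 satisfy $T(n)=o(n)$. Then there is no deterministic $\mathsf{LOCAL}$ algorithm that, for every $n$, for every $n$-vertex multihypergraph $G$ with minimum degree exactly $\delta$ and maximum rank exactly $r=\delta$, and for every such assignment of identifiers, computes an HSO of $G$ in $T(n)$ rounds. -/

import Mathlib

/-! ### The deterministic LOCAL model

A deterministic distributed algorithm on a simple graph whose nodes carry an input of type `ι` and a
unique identifier.  Local computation is unrestricted and messages have unbounded size.  Initially
a node knows its input, its own identifier and the set of identifiers of its neighbours.
In each synchronous round it sends one message to each neighbour (the neighbour being named by its
identifier) and then updates its state from the set of received pairs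
(identifier of the sender, message). -/

/-- A deterministic LOCAL algorithm with node inputs in `ι` and node outputs in `ω`. -/
structure LocalAlgorithm (ι ω : Type) where
  /-- the internal states of a node -/
  State : Type
  /-- the messages -/
  Msg : Type
  /-- initial state from the input, the own identifier and the identifiers of the neighbours -/
  init : ι → ℕ → Set ℕ → State
  /-- the message sent to the neighbour with the given identifier -/
  send : State → ℕ → Msg
  /-- the new state after receiving messages, each tagged with the identifier of its sender -/
  receive : State → Set (ℕ × Msg) → State
  /-- the output that a node in the given state announces -/
  output : State → ω

namespace LocalAlgorithm

/-- The state of each node after `t` rounds on the network `N`, where node `x` has input `input x`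
and identifier `ident x`. -/
def state {ι ω : Type} (A : LocalAlgorithm ι ω) {W : Type} (N : SimpleGraph W)
    (input : W → ι) (ident : W → ℕ) : ℕ → W → A.State
  | 0, x => A.init (input x) (ident x) {i | ∃ y, N.Adj x y ∧ i = ident y}
  | t + 1, x =>
      A.receive (A.state N input ident t x)
        {p | ∃ y, N.Adj x y ∧ p = (ident y, A.send (A.state N input ident t y) (ident x))}

end LocalAlgorithm

/-! ### Multihypergraphs -/

/-- A multihypergraph with vertex set `V` whose hyperedges are indexed by `E`: different indices may
carry the same set of vertices (parallel hyperedges).  Hyperedges are nonempty. -/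
structure MultiHypergraph (V E : Type) where
  /-- the vertices contained in a hyperedge -/
  verts : E → Finset V
  verts_nonempty : ∀ e, (verts e).Nonempty

namespace MultiHypergraph

variable {V E : Type}

/-- The degree of a vertex: the number of hyperedges containing it, with multiplicity. -/
noncomputable def degree (G : MultiHypergraph V E) (v : V) : ℕ := {e | v ∈ G.verts e}.ncard

/-- The rank of a hyperedge: the number of its vertices. -/
def rank (G : MultiHypergraph V E) (e : E) : ℕ := (G.verts e).card

/-- `δ` is the minimum vertex degree of `G`. -/
def HasMinDegree (G : MultiHypergraph V E) (δ : ℕ) : Prop := IsLeast (Set.range G.degree) δ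

/-- `r` is the maximum hyperedge rank of `G`. -/
def HasMaxRank (G : MultiHypergraph V E) (r : ℕ) : Prop := IsGreatest (Set.range G.rank) r

/-- The bipartite representation of `G`: a simple graph with one node `Sum.inl v` for each vertex
and one node `Sum.inr e` for each hyperedge, adjacent exactly when `v` belongs to `e`. -/
def bipartiteRep (G : MultiHypergraph V E) : SimpleGraph (V ⊕ E) where
  Adj
    | Sum.inl v, Sum.inr e => v ∈ G.verts e
    | Sum.inr e, Sum.inl v => v ∈ G.verts e
    | _, _ => False
  symm := ⟨by rintro (v | e) (w | f) h <;> exact h⟩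
  loopless := ⟨by rintro (v | e) h <;> exact h⟩

/-- A hypergraph sinkless orientation.  An orientation makes each hyperedge `e` outgoing for exactly
one of its vertices, `head e`, and incoming for its other vertices; it is sinkless if every vertex
has at least one outgoing hyperedge. -/
def IsHSO (G : MultiHypergraph V E) (head : E → V) : Prop :=
  (∀ e, head e ∈ G.verts e) ∧ ∀ v, ∃ e, head e = v

/-- The input of a node of the bipartite representation: the numbers of vertices and of hyperedges
of the hypergraph (known to all nodes), and whether the node is a hyperedge. -/
structure NodeInput where
  numVertices : ℕ
  numHyperedges : ℕ
  isHyperedge : Bool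

/-- The inputs of the nodes of the bipartite representation of a hypergraph on `V` and `E`. -/
def nodeInput (V E : Type) [Fintype V] [Fintype E] (x : V ⊕ E) : NodeInput :=
  ⟨Fintype.card V, Fintype.card E, x.isRight⟩

/-- The algorithm `A`, executed on the bipartite representation of `G` with identifiers `ident`,
has computed an HSO of `G` after `t` rounds: for some HSO, the output of every vertex is the set
of the identifiers of precisely those incident hyperedges that are outgoing for it.  (A node that
decides earlier keeps its output in its state.) -/
def ComputesHSO (A : LocalAlgorithm NodeInput (Set ℕ)) [Fintype V] [Fintype E]
    (G : MultiHypergraph V E) (ident : V ⊕ E → ℕ) (t : ℕ) : Prop :=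
  ∃ head : E → V, G.IsHSO head ∧
    ∀ v : V, A.output (A.state G.bipartiteRep (nodeInput V E) ident t (Sum.inl v)) =
      {i | ∃ e, head e = v ∧ i = ident (Sum.inr e)}

end MultiHypergraph

/-! Deciding which lane of the theta hypergraph serves the hub vertex is a global problem. The
hypergraph has as many hyperedges as vertices, so in an HSO each vertex has exactly one outgoing
hyperedge. Counting inside a block then shows that the orientation of the connecting hyperedges is
constant along each lane (`IsHSO.theta_step`, `IsHSO.theta_lane`), and exactly one lane is directed
into the hub vertex.

Let lane `j₁` be that lane, and exchange the identifiers of lanes `j₁` and `j₂` in the far half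
only. Near the beginning nothing visible has changed, so `j₁` still points forward. Near the hub
vertex the view is the old one up to the automorphism swapping the lanes, so `j₂` now serves the
hub. By constancy along `j₁` this is impossible. Both comparisons are instances of
`state_eq_of_agree`, valid while the number of rounds is below about half the lane length, which is
linear in `n` for fixed `δ`. -/

namespace LocalAlgorithm

/-- Locality: if `D t` consists of nodes whose distance to the nodes outside `D 0` is at least `t`
and two identifier assignments agree on `D 0` up to a network automorphism, then the states after
`t` rounds of the nodes in `D (t + 1)` correspond. -/
theorem state_eq_of_agree {ι ω W : Type} (A : LocalAlgorithm ι ω) {N : SimpleGraph W}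
    (φ : N ≃g N) {input : W → ι} (hinput : ∀ x, input (φ x) = input x) {ident ident' : W → ℕ}
    {D : ℕ → W → Prop} (hmono : ∀ t x, D (t + 1) x → D t x)
    (hadj : ∀ t x y, D (t + 1) x → N.Adj x y → D t y)
    (hident : ∀ x, D 0 x → ident' x = ident (φ x)) (t : ℕ) :
    ∀ x, D (t + 1) x → A.state N input ident' t x = A.state N input ident t (φ x) := by
  have hzero : ∀ t x, D t x → D 0 x := by
    intro t
    induction t with
    | zero => exact fun _ h => h
    | succ t ih => exact fun x h => ih x (hmono t x h)
  induction t with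
  | zero =>
    intro x hx
    have hset : {i | ∃ y, N.Adj x y ∧ i = ident' y} = {i | ∃ y, N.Adj (φ x) y ∧ i = ident y} := by
      ext i
      constructor
      · rintro ⟨y, hy, rfl⟩
        exact ⟨φ y, φ.map_adj_iff.2 hy, hident y (hadj 0 x y hx hy)⟩
      · rintro ⟨y, hy, rfl⟩
        obtain ⟨z, rfl⟩ := φ.surjective y
        have hz := φ.map_adj_iff.1 hy
        exact ⟨z, hz, (hident z (hadj 0 x z hx hz)).symm⟩
    simp only [state, hset, hinput, hident x (hmono 0 x hx)]
  | succ t ih =>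
    intro x hx
    have hstep : ∀ y, N.Adj x y →
        (ident' y, A.send (A.state N input ident' t y) (ident' x)) =
          (ident (φ y), A.send (A.state N input ident t (φ y)) (ident (φ x))) := by
      intro y hy
      have hy' := hadj (t + 1) x y hx hy
      rw [hident y (hzero _ y hy'), hident x (hzero _ x hx), ih y hy']
    have hset : {p | ∃ y, N.Adj x y ∧
          p = (ident' y, A.send (A.state N input ident' t y) (ident' x))} =
        {p | ∃ y, N.Adj (φ x) y ∧
          p = (ident y, A.send (A.state N input ident t y) (ident (φ x)))} := by
      ext p
      constructor
      · rintro ⟨y, hy, rfl⟩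
        exact ⟨φ y, φ.map_adj_iff.2 hy, hstep y hy⟩
      · rintro ⟨y, hy, rfl⟩
        obtain ⟨z, rfl⟩ := φ.surjective y
        have hz := φ.map_adj_iff.1 hy
        exact ⟨z, hz, (hstep z hz).symm⟩
    simp only [state, hset, ih x (hmono (t + 1) x hx)]

end LocalAlgorithm

/-! ### The theta hypergraph and its incidences -/

namespace MultiHypergraph

/-- The vertices, and also the hyperedges, of the theta hypergraph: `δ` lanes of `N` blocks of
`δ` elements each, and a hub `none`. -/
abbrev ThetaNode (δ N : ℕ) : Type := Option (Fin δ × Fin N × Fin δ)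

variable {δ N : ℕ}

/-- The permutation of the nodes induced by a permutation of the lanes. -/
def lanePerm (N : ℕ) (π : Equiv.Perm (Fin δ)) : Equiv.Perm (ThetaNode δ N) :=
  Equiv.optionCongr (Equiv.prodCongr π (Equiv.refl _))

@[simp] theorem lanePerm_none (π : Equiv.Perm (Fin δ)) : lanePerm N π none = none := rfl

@[simp] theorem lanePerm_some (π : Equiv.Perm (Fin δ)) (j : Fin δ) (x : Fin N × Fin δ) :
    lanePerm N π (some (j, x)) = some (π j, x) := rfl

variable [NeZero δ]

/-- The entry vertex of the block after block `i` of lane `j`; the hub after the last block. -/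
def thetaNext (j : Fin δ) (i : Fin N) : ThetaNode δ N :=
  if h : i.val + 1 < N then some (j, ⟨i + 1, h⟩, 0) else none

theorem thetaNext_of_lt (j : Fin δ) {i : Fin N} (h : i.val + 1 < N) :
    thetaNext j i = some (j, ⟨i + 1, h⟩, 0) := dif_pos h

theorem thetaNext_ne_block (j : Fin δ) (i : Fin N) (j' a : Fin δ) :
    thetaNext j i ≠ some (j', i, a) := by
  unfold thetaNext
  split_ifs
  · simp [Fin.ext_iff]
  · simp

variable [NeZero N]

/-- The vertices of a hyperedge of the theta hypergraph, indexed by `Fin δ`. -/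
def thetaVert : ThetaNode δ N → Fin δ → ThetaNode δ N
  | none, k => some (k, 0, 0)
  | some (j, i, b), k =>
      if k = 0 then (if b = 0 then thetaNext j i else some (j, i, 0)) else some (j, i, k)

variable (δ N) in
/-- The theta hypergraph.  Each block is a complete bipartite graph between `δ` vertices and `δ`
hyperedges, where the hyperedge `0` contains the vertex `0` of the next block instead of its own.
The hub vertex ends all lanes, and the hub hyperedge begins all lanes. -/
def theta : MultiHypergraph (ThetaNode δ N) (ThetaNode δ N) where
  verts e := Finset.univ.image (thetaVert e)
  verts_nonempty _ := Finset.univ_nonempty.image _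

theorem mem_theta {e v : ThetaNode δ N} : v ∈ (theta δ N).verts e ↔ ∃ k, thetaVert e k = v := by
  simp [theta]

theorem mem_theta_some_iff {j : Fin δ} {i : Fin N} {b : Fin δ} {v : ThetaNode δ N} :
    v ∈ (theta δ N).verts (some (j, i, b)) ↔
      (b = 0 ∧ v = thetaNext j i) ∨ ∃ a, v = some (j, i, a) ∧ (a ≠ 0 ∨ b ≠ 0) := by
  rw [mem_theta]
  constructor
  · rintro ⟨k, rfl⟩
    by_cases hk : k = 0 <;> by_cases hb : b = 0 <;> simp [thetaVert, hk, hb]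
  · rintro (⟨rfl, rfl⟩ | ⟨a, rfl, h⟩)
    · exact ⟨0, by simp [thetaVert]⟩
    · refine ⟨a, ?_⟩
      by_cases ha : a = 0
      · simp_all [thetaVert]
      · simp [thetaVert, ha]

theorem mem_theta_none_iff {v : ThetaNode δ N} :
    v ∈ (theta δ N).verts none ↔ ∃ j, v = some (j, 0, 0) := by
  simp [mem_theta, thetaVert, eq_comm]

theorem none_mem_theta_iff {e : ThetaNode δ N} :
    none ∈ (theta δ N).verts e ↔ ∃ j i, e = some (j, i, 0) ∧ i.val + 1 = N := by
  rcases e with _ | ⟨j, i, b⟩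
  · simp [mem_theta_none_iff]
  · have := i.isLt
    simp only [mem_theta_some_iff, thetaNext]
    split_ifs with h
    · simp; omega
    · simp; omega

/-- The hyperedges containing a vertex of a block of the theta hypergraph. -/
theorem block_mem_theta {e : ThetaNode δ N} {j a : Fin δ} {i : Fin N}
    (h : some (j, i, a) ∈ (theta δ N).verts e) :
    (∃ b, e = some (j, i, b)) ∨ (a = 0 ∧ i = 0 ∧ e = none) ∨
      (a = 0 ∧ ∃ i' : Fin N, i'.val + 1 = i ∧ e = some (j, i', 0)) := by
  rcases e with _ | ⟨j', i', b⟩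
  · rw [mem_theta_none_iff] at h
    simp_all
  · rw [mem_theta_some_iff] at h
    rcases h with ⟨rfl, h⟩ | ⟨a', h, -⟩
    · unfold thetaNext at h
      split_ifs at h with hi
      simp only [Option.some.injEq, Prod.mk.injEq] at h
      obtain ⟨rfl, rfl, rfl⟩ := h
      simp
    · simp only [Option.some.injEq, Prod.mk.injEq] at h
      obtain ⟨rfl, rfl, rfl⟩ := h
      simp

/-! ### Rank and degree -/

theorem theta_hasMaxRank : (theta δ N).HasMaxRank δ := by
  constructor
  · refine ⟨none, ?_⟩
    have hinj : Function.Injective (thetaVert (none : ThetaNode δ N)) := by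
      intro k l h
      simpa [thetaVert] using h
    simp [rank, theta, Finset.card_image_of_injective _ hinj]
  · rintro _ ⟨e, rfl⟩
    exact Finset.card_image_le.trans (by simp)

theorem le_degree_theta {v : ThetaNode δ N} {f : Fin δ → ThetaNode δ N}
    (hf : Function.Injective f) (h : ∀ k, v ∈ (theta δ N).verts (f k)) :
    δ ≤ (theta δ N).degree v := by
  calc δ = (Set.range f).ncard := by
        rw [← Set.image_univ, Set.ncard_image_of_injective _ hf]; simp [Set.ncard_univ]
    _ ≤ _ := Set.ncard_le_ncard (by rintro _ ⟨k, rfl⟩; exact h k) (Set.toFinite _)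

theorem theta_hasMinDegree : (theta δ N).HasMinDegree δ := by
  have hN := NeZero.pos N
  have hhub : ∀ k : Fin δ,
      none ∈ (theta δ N).verts (some (k, (⟨N - 1, by omega⟩ : Fin N), (0 : Fin δ))) := fun k =>
    none_mem_theta_iff.2 ⟨_, _, rfl, Nat.sub_add_cancel hN⟩
  have hhubinj : Function.Injective
      fun k : Fin δ => some (k, (⟨N - 1, by omega⟩ : Fin N), (0 : Fin δ)) := by
    intro k l h
    simpa using h
  constructor
  -- The hub vertex attains the minimum: it lies in exactly one hyperedge per lane.
  · refine ⟨none, le_antisymm ?_ (le_degree_theta hhubinj hhub)⟩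
    have hsub : {e | none ∈ (theta δ N).verts e} ⊆
        Set.range fun k : Fin δ => some (k, (⟨N - 1, by omega⟩ : Fin N), (0 : Fin δ)) := by
      intro e he
      obtain ⟨j, i, rfl, hi⟩ := none_mem_theta_iff.1 he
      exact ⟨j, by simp [Fin.ext_iff]; omega⟩
    refine (Set.ncard_le_ncard hsub (Set.toFinite _)).trans ?_
    rw [← Set.image_univ]
    exact (Set.ncard_image_le (Set.toFinite _)).trans (by simp [Set.ncard_univ])
  · rintro _ ⟨_ | ⟨j, i, a⟩, rfl⟩
    · exact le_degree_theta hhubinj hhub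
    -- Vertex `0` of a block is missing from hyperedge `0` of that block; the hub hyperedge (in
    -- block `0`) or the preceding connecting hyperedge makes up for it.
    · by_cases ha : a = 0
      · subst ha
        by_cases hi : i = 0
        · subst hi
          refine le_degree_theta
            (f := fun b => if b = 0 then none else some (j, (0 : Fin N), b)) ?_ ?_
          · intro k l h
            dsimp only at h
            split_ifs at h <;> simp_all
          · intro k
            by_cases hk : k = 0
            · simp [hk, mem_theta_none_iff]
            · simp [hk, mem_theta_some_iff]
        · have hi0 : i.val ≠ 0 := fun h => hi (Fin.ext (by simpa using h))
          have hlt := i.isLt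
          refine le_degree_theta (f := fun b => if b = 0
            then some (j, (⟨i - 1, by omega⟩ : Fin N), (0 : Fin δ)) else some (j, i, b)) ?_ ?_
          · intro k l h
            dsimp only at h
            split_ifs at h with hk hl hl
            · rw [hk, hl]
            · simp only [Option.some.injEq, Prod.mk.injEq, Fin.ext_iff] at h
              omega
            · simp only [Option.some.injEq, Prod.mk.injEq, Fin.ext_iff] at h
              omega
            · simpa using h
          · intro k
            by_cases hk : k = 0
            · simp only [hk, if_true, mem_theta_some_iff]
              left
              rw [thetaNext_of_lt (h := by dsimp only; omega)]
              simp only [Option.some.injEq, Prod.mk.injEq, Fin.ext_iff, true_and, and_true]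
              omega
            · simp [hk, mem_theta_some_iff]
      · refine le_degree_theta (f := fun b => some (j, i, b)) ?_ ?_
        · intro k l h
          simpa using h
        · intro k
          simp [mem_theta_some_iff, ha]

/-! ### Rigidity of orientations along a lane -/

/-- With equally many vertices and hyperedges, sinklessness leaves no slack: no vertex can have two
outgoing hyperedges. -/
theorem IsHSO.bijective {V : Type} [Finite V] {G : MultiHypergraph V V} {head : V → V}
    (h : G.IsHSO head) : Function.Bijective head :=
  Finite.surjective_iff_bijective.1 h.2

/-- Along a lane, a connecting hyperedge is outgoing for the next block if and only if the
following connecting hyperedge is. -/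
theorem IsHSO.theta_step {head : ThetaNode δ N → ThetaNode δ N} (h : (theta δ N).IsHSO head)
    (j : Fin δ) (i : Fin N) (hi : i.val + 1 < N) :
    head (some (j, i, 0)) = thetaNext j i ↔
      head (some (j, ⟨i + 1, hi⟩, 0)) = thetaNext j ⟨i + 1, hi⟩ := by
  rw [thetaNext_of_lt j hi]
  set i' : Fin N := ⟨i + 1, hi⟩ with hi'
  have hinj := h.bijective.injective
  constructor
  · intro hu
    by_contra hnu
    -- If no hyperedge of the block serves the next one, its `δ` hyperedges use up its `δ` vertices,
    -- including vertex `0`, which is already served from the previous block.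
    have hblock : ∀ b : Fin δ, ∃ a, head (some (j, i', b)) = some (j, i', a) := by
      intro b
      rcases mem_theta_some_iff.1 (h.1 (some (j, i', b))) with ⟨rfl, hb⟩ | ⟨a, ha, -⟩
      · exact absurd hb hnu
      · exact ⟨a, ha⟩
    choose f hf using hblock
    have hfinj : Function.Injective f := by
      intro b b' hbb
      have := hinj ((hf b).trans ((congrArg (fun a => some (j, i', a)) hbb).trans (hf b').symm))
      simpa using this
    obtain ⟨b, hb⟩ := Finite.surjective_of_injective hfinj 0
    have heq := hinj ((hf b).trans (hb ▸ hu.symm))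
    simp only [Option.some.injEq, Prod.mk.injEq, Fin.ext_iff] at heq
    have : i'.val = i.val + 1 := rfl
    omega
  · intro hu
    by_contra hnu
    -- Conversely, if nothing is received from the previous block, all `δ` hyperedges are needed
    -- inside the block, including hyperedge `0`, which leaves it.
    have hblock : ∀ a : Fin δ, ∃ b, head (some (j, i', b)) = some (j, i', a) := by
      intro a
      obtain ⟨e, he⟩ := h.2 (some (j, i', a))
      rcases block_mem_theta (he ▸ h.1 e) with ⟨b, rfl⟩ | ⟨-, h0, -⟩ | ⟨rfl, k, hk, rfl⟩
      · exact ⟨b, he⟩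
      · have : i'.val = 0 := by rw [h0]; rfl
        exact absurd this (Nat.succ_ne_zero _)
      · have hki : k = i := Fin.ext (by simpa [hi'] using hk)
        exact absurd (hki ▸ he) hnu
    choose f hf using hblock
    have hfinj : Function.Injective f := by
      intro a a' haa
      have := (hf a).symm.trans ((congrArg (fun b => head (some (j, i', b))) haa).trans (hf a'))
      simpa using this
    obtain ⟨a, ha⟩ := Finite.surjective_of_injective hfinj 0
    have := hf a
    rw [ha, hu] at this
    exact thetaNext_ne_block _ _ _ _ this

theorem IsHSO.theta_lane {head : ThetaNode δ N → ThetaNode δ N} (h : (theta δ N).IsHSO head)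
    (j : Fin δ) : ∀ (i : ℕ) (hi : i < N),
    head (some (j, 0, 0)) = thetaNext j 0 ↔
      head (some (j, ⟨i, hi⟩, 0)) = thetaNext j ⟨i, hi⟩
  | 0, _ => Iff.rfl
  | i + 1, hi => (h.theta_lane j i (by omega)).trans (h.theta_step j ⟨i, by omega⟩ hi)

/-! ### Levels and the symmetry between lanes -/

/-- The position of a node of the bipartite representation along the lanes. -/
def thetaLevel : ThetaNode δ N ⊕ ThetaNode δ N → ℕ
  | Sum.inl none => N
  | Sum.inr none => 0
  | Sum.inl (some (_, i, _)) => i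
  | Sum.inr (some (_, i, _)) => i

theorem thetaLevel_adj_aux {e v : ThetaNode δ N} (h : v ∈ (theta δ N).verts e) :
    thetaLevel (Sum.inr e) ≤ thetaLevel (Sum.inl v) ∧
      thetaLevel (Sum.inl v) ≤ thetaLevel (Sum.inr e) + 1 := by
  rcases e with _ | ⟨j, i, b⟩
  · obtain ⟨j, rfl⟩ := mem_theta_none_iff.1 h
    simp [thetaLevel]
  · have := i.isLt
    rcases mem_theta_some_iff.1 h with ⟨-, rfl⟩ | ⟨a, rfl, -⟩
    · unfold thetaNext
      split_ifs
      · simp [thetaLevel]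
      · simp [thetaLevel]; omega
    · simp [thetaLevel]

/-- Level differences bound distances from below, so a margin in level serves as the margin that
locality needs. -/
theorem thetaLevel_adj {x y : ThetaNode δ N ⊕ ThetaNode δ N}
    (h : (theta δ N).bipartiteRep.Adj x y) :
    thetaLevel x ≤ thetaLevel y + 1 ∧ thetaLevel y ≤ thetaLevel x + 1 := by
  rcases x with v | e <;> rcases y with w | f
  · exact h.elim
  · have := thetaLevel_adj_aux (show v ∈ (theta δ N).verts f from h)
    omega
  · have := thetaLevel_adj_aux (show w ∈ (theta δ N).verts e from h)
    omega
  · exact h.elim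

theorem lanePerm_mem (π : Equiv.Perm (Fin δ)) {e v : ThetaNode δ N}
    (h : v ∈ (theta δ N).verts e) : lanePerm N π v ∈ (theta δ N).verts (lanePerm N π e) := by
  rcases e with _ | ⟨j, i, b⟩
  · obtain ⟨j, rfl⟩ := mem_theta_none_iff.1 h
    exact mem_theta_none_iff.2 ⟨π j, rfl⟩
  · rw [lanePerm_some, mem_theta_some_iff]
    rcases mem_theta_some_iff.1 h with ⟨hb, rfl⟩ | ⟨a, rfl, hab⟩
    · refine Or.inl ⟨hb, ?_⟩
      unfold thetaNext
      split_ifs <;> simp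
    · exact Or.inr ⟨a, rfl, hab⟩

theorem lanePerm_mem_iff (π : Equiv.Perm (Fin δ)) {e v : ThetaNode δ N} :
    lanePerm N π v ∈ (theta δ N).verts (lanePerm N π e) ↔ v ∈ (theta δ N).verts e := by
  refine ⟨fun h => ?_, lanePerm_mem π⟩
  have hinv : ∀ x, lanePerm N π⁻¹ (lanePerm N π x) = x := by
    rintro (_ | ⟨j, x⟩) <;> simp
  simpa only [hinv] using lanePerm_mem π⁻¹ h

/-- The automorphism of the bipartite representation induced by a permutation of the lanes. -/
def laneIso (N : ℕ) [NeZero N] (π : Equiv.Perm (Fin δ)) :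
    (theta δ N).bipartiteRep ≃g (theta δ N).bipartiteRep where
  toEquiv := Equiv.sumCongr (lanePerm N π) (lanePerm N π)
  map_rel_iff' := by
    rintro (v | e) (w | f)
    · exact Iff.rfl
    · exact lanePerm_mem_iff π
    · exact lanePerm_mem_iff π
    · exact Iff.rfl

@[simp] theorem laneIso_inl (π : Equiv.Perm (Fin δ)) (v : ThetaNode δ N) :
    laneIso N π (Sum.inl v) = Sum.inl (lanePerm N π v) := rfl

@[simp] theorem laneIso_inr (π : Equiv.Perm (Fin δ)) (e : ThetaNode δ N) :
    laneIso N π (Sum.inr e) = Sum.inr (lanePerm N π e) := rfl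

theorem thetaLevel_laneIso (π : Equiv.Perm (Fin δ)) (x : ThetaNode δ N ⊕ ThetaNode δ N) :
    thetaLevel (laneIso N π x) = thetaLevel x := by
  rcases x with (_ | ⟨j, i, a⟩) | (_ | ⟨j, i, a⟩) <;> rfl

/-- Apply a lane permutation to the nodes at level at least `M` only. -/
def cutPerm (N M : ℕ) [NeZero N] (π : Equiv.Perm (Fin δ)) (x : ThetaNode δ N ⊕ ThetaNode δ N) :
    ThetaNode δ N ⊕ ThetaNode δ N :=
  if thetaLevel x < M then x else laneIso N π x

theorem cutPerm_of_lt {M : ℕ} (π : Equiv.Perm (Fin δ)) {x : ThetaNode δ N ⊕ ThetaNode δ N}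
    (h : thetaLevel x < M) : cutPerm N M π x = x := if_pos h

theorem cutPerm_of_le {M : ℕ} (π : Equiv.Perm (Fin δ)) {x : ThetaNode δ N ⊕ ThetaNode δ N}
    (h : M ≤ thetaLevel x) : cutPerm N M π x = laneIso N π x := if_neg (by omega)

/-- Lane permutations preserve levels, so the moved and the fixed nodes cannot collide. -/
theorem cutPerm_injective (M : ℕ) (π : Equiv.Perm (Fin δ)) :
    Function.Injective (cutPerm N M π) := by
  intro x y h
  have hx := thetaLevel_laneIso π x
  have hy := thetaLevel_laneIso π y
  unfold cutPerm at h
  split_ifs at h with h1 h2 h2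
  · exact h
  · rw [← h] at hy; omega
  · rw [h] at hx; omega
  · exact (laneIso N π).injective h

/-! ### The indistinguishability argument -/

variable {V E : Type} [Fintype V] [Fintype E]

theorem mem_output_iff {A : LocalAlgorithm NodeInput (Set ℕ)} {G : MultiHypergraph V E}
    {ident : V ⊕ E → ℕ} (hident : Function.Injective ident) {t : ℕ} {head : E → V} {v : V}
    (h : A.output (A.state G.bipartiteRep (nodeInput V E) ident t (Sum.inl v)) =
      {i | ∃ e, head e = v ∧ i = ident (Sum.inr e)}) (e : E) :
    ident (Sum.inr e) ∈
      A.output (A.state G.bipartiteRep (nodeInput V E) ident t (Sum.inl v)) ↔ head e = v := by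
  rw [h]
  constructor
  · rintro ⟨f, hf, hef⟩
    rwa [Sum.inr_injective (hident hef)]
  · exact fun he => ⟨e, he, rfl⟩

/-- Fewer than `M - 2` rounds do not suffice on the theta hypergraph with lanes of length `2 * M`,
for identifiers from any set that contains enough of them. -/
theorem theta_not_computesHSO {M t : ℕ} [NeZero (2 * M)] (hδ : 2 ≤ δ) (hM : t + 2 < M)
    (A : LocalAlgorithm NodeInput (Set ℕ)) {ident : ThetaNode δ (2 * M) ⊕ ThetaNode δ (2 * M) → ℕ}
    (hident : Function.Injective ident) :
    ¬ ∀ σ : ThetaNode δ (2 * M) ⊕ ThetaNode δ (2 * M) → ThetaNode δ (2 * M) ⊕ ThetaNode δ (2 * M),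
      Function.Injective σ → ComputesHSO A (theta δ (2 * M)) (ident ∘ σ) t := by
  intro hall
  have hlast : 2 * M - 1 < 2 * M := by omega
  have hnext : ∀ j : Fin δ, thetaNext j (⟨2 * M - 1, hlast⟩ : Fin (2 * M)) = none :=
    fun j => dif_neg (by simp; omega)
  obtain ⟨head, hso, hout⟩ := hall id Function.injective_id
  rw [Function.comp_id] at hout
  obtain ⟨e, he⟩ := hso.2 none
  obtain ⟨j₁, i, rfl, hi⟩ := none_mem_theta_iff.1 (he ▸ hso.1 e)
  obtain rfl : i = ⟨2 * M - 1, hlast⟩ := Fin.ext (by simp; omega)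
  have : Nontrivial (Fin δ) := Fin.nontrivial_iff_two_le.2 hδ
  obtain ⟨j₂, hj⟩ := exists_ne j₁
  set π : Equiv.Perm (Fin δ) := Equiv.swap j₁ j₂ with hπ
  have hσ := cutPerm_injective (N := 2 * M) M π
  obtain ⟨head', hso', hout'⟩ := hall _ hσ
  have hident' := hident.comp hσ
  have hstart : head (some (j₁, 0, 0)) = thetaNext j₁ 0 :=
    (hso.theta_lane j₁ _ hlast).2 (he.trans (hnext j₁).symm)
  have hone : ((0 : Fin (2 * M)) : ℕ) + 1 < 2 * M := by simp; omega
  -- The output is read at the vertex at level `1`, and `t + 1` levels of margin are needed: this is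
  -- `t + 2 < M`.
  have hleft : head' (some (j₁, 0, 0)) = thetaNext j₁ 0 := by
    have hstate := A.state_eq_of_agree (SimpleGraph.Iso.refl (G := (theta δ (2 * M)).bipartiteRep))
      (input := nodeInput (ThetaNode δ (2 * M)) (ThetaNode δ (2 * M))) (fun _ => rfl)
      (ident := ident) (ident' := ident ∘ cutPerm (2 * M) M π)
      (D := fun k x => thetaLevel x + k < M) (fun _ _ h => by omega)
      (fun _ _ _ h hxy => by have := thetaLevel_adj hxy; omega)
      (fun x hx => congrArg ident (cutPerm_of_lt π hx)) t (Sum.inl (thetaNext j₁ 0))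
      (by rw [thetaNext_of_lt j₁ hone]; simp [thetaLevel]; omega)
    rw [← mem_output_iff hident' (hout' _), hstate, Function.comp_apply,
      cutPerm_of_lt π (by simp [thetaLevel]; omega)]
    exact (mem_output_iff hident (hout _) _).2 hstart
  have hright := (hso'.theta_lane j₁ _ hlast).1 hleft
  have hstate := A.state_eq_of_agree (laneIso (2 * M) π)
    (input := nodeInput (ThetaNode δ (2 * M)) (ThetaNode δ (2 * M)))
    (by rintro (v | e) <;> rfl) (ident := ident) (ident' := ident ∘ cutPerm (2 * M) M π)
    (D := fun k x => M + k ≤ thetaLevel x) (fun _ _ h => by omega)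
    (fun _ _ _ h hxy => by have := thetaLevel_adj hxy; omega)
    (fun x hx => congrArg ident (cutPerm_of_le π hx)) t (Sum.inl none)
    (by simp [thetaLevel]; omega)
  -- The last hyperedge of lane `j₁` now carries the old identifier of its counterpart in `j₂`, so
  -- in the original run the hub would be served from `j₂` too.
  rw [hnext, ← mem_output_iff hident' (hout' _), hstate, Function.comp_apply,
    cutPerm_of_le π (by simp [thetaLevel]; omega), laneIso_inl, laneIso_inr, lanePerm_none,
    lanePerm_some, mem_output_iff hident (hout _), hπ, Equiv.swap_apply_left] at hright
  have := hso.bijective.injective (hright.trans he.symm)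
  simp [hj] at this

end MultiHypergraph

/-! ### Choice of the parameters -/

theorem theorem1p5 (δ : ℕ) (hδ : 2 ≤ δ) (c : ℕ) (hc : 1 ≤ c) (T : ℕ → ℕ)
    (hT : Asymptotics.IsLittleO Filter.atTop (fun n : ℕ => (T n : ℝ)) (fun n : ℕ => (n : ℝ))) :
    ¬ ∃ A : LocalAlgorithm MultiHypergraph.NodeInput (Set ℕ),
      ∀ (V E : Type) [Fintype V] [Fintype E] (G : MultiHypergraph V E),
        G.HasMinDegree δ → G.HasMaxRank δ →
        ∀ ident : V ⊕ E → ℕ, Function.Injective ident →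
          (∀ x, ident x ∈ Set.Icc 1 ((Fintype.card V + Fintype.card E) ^ c)) →
          MultiHypergraph.ComputesHSO A G ident (T (Fintype.card V)) := by
  rintro ⟨A, hA⟩
  have : NeZero δ := ⟨by omega⟩
  have hδ0 : (0 : ℝ) < δ := by exact_mod_cast (by omega : 0 < δ)
  have hδ1 : (1 : ℝ) ≤ δ := by exact_mod_cast (by omega : 1 ≤ δ)
  -- As `n = 2δ²M + 1`, this constant gives `T n ≤ M / 4 + 1`, hence `T n + 2 < M` once `M ≥ 5`.
  obtain ⟨n₀, hn₀⟩ := Filter.eventually_atTop.1 (hT.def (c := 1 / (8 * (δ : ℝ) ^ 2)) (by positivity))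
  set M := n₀ + 5 with hM
  have : NeZero (2 * M) := ⟨by omega⟩
  set n := Fintype.card (MultiHypergraph.ThetaNode δ (2 * M)) with hn
  have hcard : n = 2 * δ ^ 2 * M + 1 := by
    simp [hn, MultiHypergraph.ThetaNode]
    ring
  have hTn : T n + 2 < M := by
    have hle : n₀ ≤ n := by
      have : 1 ≤ 2 * δ ^ 2 := by have := Nat.pow_pos (n := 2) (by omega : 0 < δ); omega
      nlinarith
    have h := hn₀ n hle
    simp only [Real.norm_natCast] at h
    have hbound : 1 / (8 * (δ : ℝ) ^ 2) * n ≤ M / 4 + 1 := by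
      rw [hcard, one_div, inv_mul_le_iff₀ (by positivity)]
      push_cast
      nlinarith [one_le_pow₀ hδ1 (n := 2)]
    have hM5 : (5 : ℝ) ≤ M := by rw [hM]; push_cast; linarith [n₀.cast_nonneg (α := ℝ)]
    have : (T n : ℝ) + 2 < M := by linarith
    exact_mod_cast this
  have e := Fintype.equivFin (MultiHypergraph.ThetaNode δ (2 * M) ⊕
    MultiHypergraph.ThetaNode δ (2 * M))
  have hinj : Function.Injective fun x => (e x : ℕ) + 1 := fun x y h =>
    e.injective (Fin.ext (Nat.succ_injective h))
  refine MultiHypergraph.theta_not_computesHSO hδ hTn A hinj fun σ hσ =>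
    hA _ _ _ MultiHypergraph.theta_hasMinDegree MultiHypergraph.theta_hasMaxRank _
      (hinj.comp hσ) fun x => ⟨Nat.le_add_left 1 _, ?_⟩
  exact ((Nat.succ_le_of_lt (e (σ x)).isLt).trans_eq Fintype.card_sum).trans (Nat.le_self_pow (by omega) _)
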